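/- **Definitions.** Alphabets are finite, and languages consist of nonempty words. A *transducer* over $\Gamma$ is a finite automaton with one initial state and labels in $(\Gamma\cup\{\varepsilon\})\times(\Gamma\cup\{\varepsilon\})$; it accepts a relation on $\Gamma^*$. It is *synchronous* if all its labels are in $\Gamma\times\Gamma$, and *sequential* if for all transitions $q\xrightarrow{x/y}q'$ and $q\xrightarrow{x'/y'}q''$ either $x=x'$, $y=y'$, $q'=q''$, or $x\ne\varepsilon$, $x'\ne\varepsilon$, $x\neq x'$. A *rational graph* $G=(T_e)_{e\in\Sigma}$ has vertex set $\Gamma^*$ and an edge $u\xrightarrow{e}v$ whenever $(u,v)\in T_e$; it is a *sequential synchronous graph* if all the $T_e$ are sequential and synchronous. $L(G,I,F)$ is the set of labels $w\in\Sigma^+$ of paths from a vertex in $I$ to a vertex in $F$. A *tiling system* $S=(\Lambda,\Sigma,\#,\Delta)$ consists of a finite alphabet $\Lambda\supseteq\Sigma$, a symbol $\#\notin\Lambda$ and a set $\Delta$ of $2\times2$ arrays (tiles) over $\Lambda\cup\{\#\}$. $L(S)$ is the set of words $w\in\Sigma^+$ that are the first row of a nonempty array $p$ over $\Lambda$ such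 that all the $2\times 2$ blocks of $p_\#$ ($p$ surrounded by a frame of $\#$) are in $\Delta$. $S$ is *deterministic* if for every word $u$ over $\Lambda$ there is at most one word $v$ over $\Lambda$, $|v|=|u|$, such that all the $2\times2$ blocks of the two-row array with rows $\#u\#$ and $\#v\#$ are in $\Delta$. A language is *deterministic context-sensitive* if it is $L(S)$ for a deterministic tiling system $S$. **Construction.** Let $G=(T_e)_{e\in\Sigma}$ be a synchronous graph with vertices in $\Gamma^*$, and let $I,F\subseteq\Gamma^*$ be the languages of finite automata $M_I,M_F$. Take new letters $i\neq f$, and let $T_I=\{(i^{|u|},u): u\in I\}$, $T_F=\{(v,f^{|v|}): v\in F\}$. For $e\in\Sigma$ let $H_e$ be the automaton over pairs of letters, obtained as a product from $T_e,M_I,M_F$, for the relation $$T_e\ \cup\ T_I\circ T_e\ \cup\ T_e\circ T_F\ \cup\ T_I\circ T_e\circ T_F$$ (compositions read from left to right), and let $D_e$ be its determinization by accessible nonempty subsets, with initial state $q_0^e$ and state set $Q_e$ (the $Q_e$ being taken disjoint). The tiling system $S(G,M_I,M_F)$ has work letters the $a\in\Sigma$ and the pairs $x\,p$ with $x\in\Gamma\cup\{i,f\}$,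 $p\in\bigcup_eQ_e$. Writing a tile as (first row / second row), its tiles are * $(\#\,\#/\#\,a)$, $(\#\,\#/b\,c)$, $(\#\,\#/d\,\#)$, for $a,b,c,d\in\Sigma$; * $(\#\ a/\#\ xp)$ if $q_0^a\xrightarrow{i/x}p$ in $D_a$; $(b\ c/yq\ zr)$ if $q_0^c\xrightarrow{y/z}r$ in $D_c$; $(d\ \#/fs\ \#)$ if $s\in Q_d$; * $(\#\ xp/\#\ x'p')$ if $p\xrightarrow{i/x'}p'$ in some $D_a$; $(yq\ zr/y'q'\ z'r')$ if $r\xrightarrow{y'/z'}r'$ in some $D_b$; $(fs\ \#/fs'\ \#)$ if $s,s'$ are in the same $Q_c$; * $(\#\ xp/\#\ \#)$, $(yq\ zr/\#\ \#)$, $(fs\ \#/\#\ \#)$ for final states $p,q,r,s$; * if $\varepsilon\in I\cap F$: $(\#\ a/\#\ \#)$, $(b\ c/\#\ \#)$, $(d\ \#/\#\ \#)$ for those $a,b,c,d\in\Sigma$ whose transducers $T_a,T_b,T_c,T_d$ accept $(\varepsilon,\varepsilon)$. **Proposition.** Let $G$ be a sequential synchronous graph with vertices in $\Gamma^*$, and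 let $a\in\Gamma$. 1. For every rational set $F\subseteq\Gamma^*$ of final vertices, $L(G,\{a\}^*,F)$ is a deterministic context-sensitive language. 2. For every finite automaton $M_F$, with language $F$, the tiling system $S(G,M_a,M_F)$, where $M_a$ is the one-state automaton of $\{a\}^*$, is deterministic, and $L(S(G,M_a,M_F))=L(G,\{a\}^*,F)$. -/

import Mathlib

open scoped Computability

/-! ### Pictures and tiling systems -/

/-- An `(n, m)`-picture over `A`: `n` rows, `m` columns. -/
abbrev Picture (A : Type) (n m : ℕ) : Type := Fin n → Fin m → A

/-- A tile is a `(2, 2)`-picture; `tile nw ne sw se` has rows `nw ne` and `sw se`. -/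
def tile {A : Type} (nw ne sw se : A) : Picture A 2 2 := ![![nw, ne], ![sw, se]]

/-- The set `T(p)` of tiles appearing in a picture `p`. -/
def Picture.tiles {A : Type} {n m : ℕ} (p : Picture A n m) : Set (Picture A 2 2) :=
  {t | ∃ (i j : ℕ) (hi : i + 1 < n) (hj : j + 1 < m),
    t = tile (p ⟨i, by omega⟩ ⟨j, by omega⟩) (p ⟨i, by omega⟩ ⟨j + 1, hj⟩)
      (p ⟨i + 1, hi⟩ ⟨j, by omega⟩) (p ⟨i + 1, hi⟩ ⟨j + 1, hj⟩)}

/-- The sequence `b u₁ … uₙ b`. -/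
def border {A : Type} {n : ℕ} (b : A) (u : Fin n → A) : Fin (n + 2) → A := fun i =>
  if h : 1 ≤ i.val ∧ i.val ≤ n then u ⟨i.val - 1, by omega⟩ else b

/-- The framed row `# u #`; the frame symbol `#` is `none : Option A`, hence is not in `A`. -/
def frameRow {A : Type} {m : ℕ} (u : Fin m → A) : Fin (m + 2) → Option A :=
  border none (fun j => some (u j))

/-- The framed picture `p_#`. -/
def Picture.frame {A : Type} {n m : ℕ} (p : Picture A n m) : Picture (Option A) (n + 2) (m + 2) :=
  border (fun _ => none) (fun i => frameRow (p i))

/-- A tiling system with input alphabet `Λ` (embedded in the finite work alphabet `Alphabet`). The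
frame symbol is `none`. -/
structure TilingSystem (Λ : Type) where
  Alphabet : Type
  finite_alphabet : Finite Alphabet
  input : Λ ↪ Alphabet
  tiles : Set (Picture (Option Alphabet) 2 2)

namespace TilingSystem

variable {Λ : Type}

/-- `p ∈ P(S)`: all the tiles of the framed picture belong to the tiling system. -/
def Accepts (S : TilingSystem Λ) {n m : ℕ} (p : Picture S.Alphabet n m) : Prop :=
  p.frame.tiles ⊆ S.tiles

/-- The word language of `S`: the words over `Λ` that are the first row of some nonempty picture
of `P(S)`. -/
def language (S : TilingSystem Λ) : Language Λ :=
  {w | ∃ (n m : ℕ) (hn : 0 < n) (_ : 0 < m) (p : Picture S.Alphabet n m), S.Accepts p ∧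
    w.map S.input = List.ofFn (p ⟨0, hn⟩)}

/-- The row `v` may follow the row `u`: the two-row picture with rows `# u #` and `# v #` only
has tiles of `S`. -/
def NextRow (S : TilingSystem Λ) {m : ℕ} (u v : Fin m → S.Alphabet) : Prop :=
  Picture.tiles (n := 2) ![frameRow u, frameRow v] ⊆ S.tiles

/-- A tiling system is deterministic if every row has at most one possible next row. -/
def Deterministic (S : TilingSystem Λ) : Prop :=
  ∀ (m : ℕ) (u v₁ v₂ : Fin m → S.Alphabet), S.NextRow u v₁ → S.NextRow u v₂ → v₁ = v₂

end TilingSystem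

/-- A language is deterministic context-sensitive if some deterministic tiling system
recognizes it. (Such a language does not contain the empty word.) -/
def IsDeterministicContextSensitive {Λ : Type} (L : Language Λ) : Prop :=
  ∃ S : TilingSystem Λ, S.Deterministic ∧ S.language = L

/-! ### Transducers and rational graphs -/

/-- A finite transducer over `Γ`; its labels are pairs in `(Γ ∪ {ε}) × (Γ ∪ {ε})`, the empty word
being `none`. -/
structure Transducer (Γ : Type) where
  State : Type
  finite_state : Finite State
  start : State
  accept : Set State
  trans : State → Option Γ → Option Γ → State → Prop

namespace Transducer

variable {Γ : Type}

/-- `T.Run p u v q`: there is a run from `p` to `q` labelled by `(u, v)`. -/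
inductive Run (T : Transducer Γ) : T.State → List Γ → List Γ → T.State → Prop
  | nil (q : T.State) : Run T q [] [] q
  | cons {p q r : T.State} {x y : Option Γ} {u v : List Γ} :
      T.trans p x y q → Run T q u v r → Run T p (x.toList ++ u) (y.toList ++ v) r

/-- The relation `(u, v) ∈ T` accepted by the transducer. -/
def Rel (T : Transducer Γ) (u v : List Γ) : Prop := ∃ q ∈ T.accept, T.Run T.start u v q

/-- All the labels are in `Γ × Γ`. -/
def IsSynchronous (T : Transducer Γ) : Prop :=
  ∀ p x y q, T.trans p x y q → x ≠ none ∧ y ≠ none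

def IsSequential (T : Transducer Γ) : Prop :=
  ∀ p x y q x' y' q', T.trans p x y q → T.trans p x' y' q' →
    (x = x' ∧ y = y' ∧ q = q') ∨ (x ≠ none ∧ x' ≠ none ∧ x ≠ x')

end Transducer

/-- A rational graph labelled by `Λ` with vertices in `Γ*`, given by its transducers. -/
abbrev RationalGraph (Λ Γ : Type) : Type 1 := Λ → Transducer Γ

namespace RationalGraph

variable {Λ Γ : Type}

def IsSynchronous (G : RationalGraph Λ Γ) : Prop := ∀ e, (G e).IsSynchronous

def IsSequential (G : RationalGraph Λ Γ) : Prop := ∀ e, (G e).IsSequential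

/-- `G.HasPath w u v`: there is a path from `u` to `v` labelled by `w`. -/
inductive HasPath (G : RationalGraph Λ Γ) : List Λ → List Γ → List Γ → Prop
  | nil (u : List Γ) : HasPath G [] u u
  | cons {e : Λ} {w : List Λ} {u v t : List Γ} :
      (G e).Rel u v → HasPath G w v t → HasPath G (e :: w) u t

/-- The path language `L(G, I, F)`. Languages are sets of nonempty words here. -/
def pathLanguage (G : RationalGraph Λ Γ) (I F : Language Γ) : Language Λ :=
  {w | w ≠ [] ∧ ∃ s ∈ I, ∃ t ∈ F, G.HasPath w s t}

end RationalGraph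

/-! ### From synchronous graphs to tiling systems -/

/-- The vertex alphabet `Γ` together with two new letters `i` and `f`. -/
inductive VLetter (Γ : Type) : Type
  | old (x : Γ) : VLetter Γ
  | i : VLetter Γ
  | f : VLetter Γ

instance {Γ : Type} [Finite Γ] : Finite (VLetter Γ) :=
  Finite.of_surjective
    (fun o : Option (Option Γ) => match o with
      | none => VLetter.i
      | some none => VLetter.f
      | some (some x) => VLetter.old x)
    (fun l => match l with
      | .i => ⟨none, rfl⟩
      | .f => ⟨some none, rfl⟩
      | .old x => ⟨some (some x), rfl⟩)

/-- Transitions of an automaton for `Id ∪ T_M`, where `Id` is the identity relation on `Γ*` (state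
`none`) and `T_M` pairs every word `u` accepted by `M` with the word `z^|u|` (states `some s`). Here
`l` is the letter over the extended alphabet and `c` the corresponding letter of `Γ`. -/
def sideStep {Γ Q : Type} (M : NFA Γ Q) (z : VLetter Γ) :
    Option Q → VLetter Γ → Γ → Option Q → Prop
  | none, l, c, none => l = .old c
  | some s, l, c, some s' => l = z ∧ s' ∈ M.step s c
  | _, _, _, _ => False

/-- For a synchronous transducer `T`, an automaton over pairs of letters for the relation
`(Id ∪ T_I) ∘ T ∘ (Id ∪ T_F)`, i.e. the union of `T`, `T_I ∘ T`, `T ∘ T_F` and `T_I ∘ T ∘ T_F`, where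
`T_I = {(i^|u|, u) | u ∈ I}`, `T_F = {(v, f^|v|) | v ∈ F}`, and `I`, `F` are the languages of `MI`, `MF`.
Compositions are read from left to right. -/
def Transducer.extend {Γ QI QF : Type} (T : Transducer Γ) (MI : NFA Γ QI) (MF : NFA Γ QF) :
    NFA (VLetter Γ × VLetter Γ) (Option QI × T.State × Option QF) where
  step s l := {s' | ∃ c d : Γ, sideStep MI .i s.1 l.1 c s'.1 ∧
    T.trans s.2.1 (some c) (some d) s'.2.1 ∧ sideStep MF .f s.2.2 l.2 d s'.2.2}
  start := {s | (∀ p ∈ s.1, p ∈ MI.start) ∧ s.2.1 = T.start ∧ ∀ r ∈ s.2.2, r ∈ MF.start}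
  accept := {s | (∀ p ∈ s.1, p ∈ MI.accept) ∧ s.2.1 ∈ T.accept ∧ ∀ r ∈ s.2.2, r ∈ MF.accept}

/-- Control states of the determinized automaton: the accessible nonempty sets of states. -/
abbrev DetState {A Q : Type} (N : NFA A Q) : Type :=
  {P : Set Q // P.Nonempty ∧ ∃ w : List A, N.eval w = P}

namespace RationalGraph

variable {Λ Γ QI QF : Type}

/-- The disjoint union of the sets of control states of the determinized transducers. -/
abbrev Control (G : RationalGraph Λ Γ) (MI : NFA Γ QI) (MF : NFA Γ QF) : Type :=
  (e : Λ) × DetState ((G e).extend MI MF)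

/-- The control state `q` is the initial state of its transducer. -/
def Control.IsStart {G : RationalGraph Λ Γ} {MI : NFA Γ QI} {MF : NFA Γ QF}
    (q : G.Control MI MF) : Prop :=
  q.2.1 = ((G q.1).extend MI MF).start

/-- The control state `q` is a final state of its transducer. -/
def Control.IsFinal {G : RationalGraph Λ Γ} {MI : NFA Γ QI} {MF : NFA Γ QF}
    (q : G.Control MI MF) : Prop :=
  ∃ s ∈ q.2.1, s ∈ ((G q.1).extend MI MF).accept

/-- The transition `p --x/y--> q` in one of the determinized transducers. -/
inductive Control.Trans {G : RationalGraph Λ Γ} {MI : NFA Γ QI} {MF : NFA Γ QF} :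
    G.Control MI MF → VLetter Γ → VLetter Γ → G.Control MI MF → Prop
  | intro {e : Λ} {P P' : DetState ((G e).extend MI MF)} {x y : VLetter Γ} :
      P'.1 = ((G e).extend MI MF).stepSet P.1 (x, y) → Control.Trans ⟨e, P⟩ x y ⟨e, P'⟩

/-- Work letters of the tiling system: edge labels, and vertex letters with a control state. -/
abbrev TLetter (G : RationalGraph Λ Γ) (MI : NFA Γ QI) (MF : NFA Γ QF) : Type :=
  Λ ⊕ (VLetter Γ × G.Control MI MF)

/-- An edge label, as an entry of a framed picture. -/
def lab (G : RationalGraph Λ Γ) (MI : NFA Γ QI) (MF : NFA Γ QF) (e : Λ) :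
    Option (G.TLetter MI MF) := some (.inl e)

/-- A vertex letter with a control state, as an entry of a framed picture. -/
def cell (G : RationalGraph Λ Γ) (MI : NFA Γ QI) (MF : NFA Γ QF) (x : VLetter Γ)
    (q : G.Control MI MF) : Option (G.TLetter MI MF) := some (.inr (x, q))

/-- The empty word is an initial and a final vertex. -/
def EmptyVertex (MI : NFA Γ QI) (MF : NFA Γ QF) : Prop := [] ∈ MI.accepts ∧ [] ∈ MF.accepts

/-- The tiles of the tiling system of a synchronous graph. The constructors `empty_left`, `empty_mid`
and `empty_right` only serve the paths that stay on the empty vertex. -/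
inductive SynchTile (G : RationalGraph Λ Γ) (MI : NFA Γ QI) (MF : NFA Γ QF) :
    Picture (Option (G.TLetter MI MF)) 2 2 → Prop
  | top_left (a : Λ) : SynchTile G MI MF (tile none none none (G.lab MI MF a))
  | top_mid (b c : Λ) : SynchTile G MI MF (tile none none (G.lab MI MF b) (G.lab MI MF c))
  | top_right (d : Λ) : SynchTile G MI MF (tile none none (G.lab MI MF d) none)
  | first_left (x : VLetter Γ) (p₀ p : G.Control MI MF) :
      p₀.IsStart → p₀.Trans .i x p →
      SynchTile G MI MF (tile none (G.lab MI MF p₀.1) none (G.cell MI MF x p))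
  | first_mid (b : Λ) (y z : VLetter Γ) (q r₀ r : G.Control MI MF) :
      r₀.IsStart → r₀.Trans y z r →
      SynchTile G MI MF
        (tile (G.lab MI MF b) (G.lab MI MF r₀.1) (G.cell MI MF y q) (G.cell MI MF z r))
  | first_right (s : G.Control MI MF) :
      SynchTile G MI MF (tile (G.lab MI MF s.1) none (G.cell MI MF .f s) none)
  | left (x x' : VLetter Γ) (p p' : G.Control MI MF) :
      p.Trans .i x' p' →
      SynchTile G MI MF (tile none (G.cell MI MF x p) none (G.cell MI MF x' p'))
  | mid (y y' z z' : VLetter Γ) (q q' r r' : G.Control MI MF) :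
      r.Trans y' z' r' →
      SynchTile G MI MF
        (tile (G.cell MI MF y q) (G.cell MI MF z r) (G.cell MI MF y' q') (G.cell MI MF z' r'))
  | right (s s' : G.Control MI MF) :
      s.1 = s'.1 →
      SynchTile G MI MF (tile (G.cell MI MF .f s) none (G.cell MI MF .f s') none)
  | bottom_left (x : VLetter Γ) (p : G.Control MI MF) :
      p.IsFinal → SynchTile G MI MF (tile none (G.cell MI MF x p) none none)
  | bottom_mid (y z : VLetter Γ) (q r : G.Control MI MF) :
      q.IsFinal → r.IsFinal →
      SynchTile G MI MF (tile (G.cell MI MF y q) (G.cell MI MF z r) none none)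
  | bottom_right (s : G.Control MI MF) :
      s.IsFinal → SynchTile G MI MF (tile (G.cell MI MF .f s) none none none)
  | empty_left (a : Λ) :
      EmptyVertex MI MF → (G a).Rel [] [] →
      SynchTile G MI MF (tile none (G.lab MI MF a) none none)
  | empty_mid (b c : Λ) :
      EmptyVertex MI MF → (G b).Rel [] [] → (G c).Rel [] [] →
      SynchTile G MI MF (tile (G.lab MI MF b) (G.lab MI MF c) none none)
  | empty_right (d : Λ) :
      EmptyVertex MI MF → (G d).Rel [] [] →
      SynchTile G MI MF (tile (G.lab MI MF d) none none none)

/-- The tiling system of a synchronous graph `G` between the languages of `MI` and `MF`. -/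
def toTilingSystem [Finite Λ] [Finite Γ] [Finite QI] [Finite QF] (G : RationalGraph Λ Γ)
    (MI : NFA Γ QI) (MF : NFA Γ QF) : TilingSystem Λ where
  Alphabet := G.TLetter MI MF
  finite_alphabet := by
    have : ∀ e, Finite (G e).State := fun e => (G e).finite_state
    infer_instance
  input := ⟨Sum.inl, Sum.inl_injective⟩
  tiles := {t | SynchTile G MI MF t}

end RationalGraph

/-- The one-state automaton of `{a}*`. -/
def starNFA {Γ : Type} (a : Γ) : NFA Γ Unit where
  step _ x := {_s | x = a}
  start := Set.univ
  accept := Set.univ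

/-! Read a picture by columns. Column `j` starts with the edge label `w j`; the entries below carry
a vertex letter and a control state, and the tiles say that going down the column is a run of the
determinized automaton of `w j` on the pairs (letter on the left, letter of the column). The frame
counts as a letter `i` on the left, the last column must hold `f`, and the bottom tiles ask for
final states. With `k > 0` rows below the labels, a picture thus amounts to an array whose
neighbouring columns form pairs accepted by `(G (w j)).extend MI MF`. A left side made of `i` stands
for an initial vertex and a right side made of `f` for a final one. An inner column is the output of
one automaton and the input of the next; outputs never use `i` and inputs never use `f`, so it is a
word over `Γ`. These words are the vertices of a path. Synchronous transducers preserve length, so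
every path fits into such an array; paths on the empty vertex have their own tiles. This gives the
language equality for every synchronous graph (`toTilingSystem_language`).

For determinism, a next row is found from left to right. When the initial set is `{a}*`, the left
letter fixes the letter read by the transducer: `old c` stands for `c` and `i` for `a`. All members
of an accessible subset share their transducer state, so sequentiality fixes the output letter `d`.
The remaining choice between `old d` and `f` is settled by the position: `f` is forced in the last
column, and excluded elsewhere because the next column could not read it
(`toTilingSystem_deterministic`). The first claim follows by choosing an automaton for `F`. -/

theorem tile_inj {A : Type} {a b c d a' b' c' d' : A} :
    tile a b c d = tile a' b' c' d' ↔ a = a' ∧ b = b' ∧ c = c' ∧ d = d' := by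
  constructor
  · intro h
    exact ⟨congrFun (congrFun h 0) 0, congrFun (congrFun h 0) 1, congrFun (congrFun h 1) 0,
      congrFun (congrFun h 1) 1⟩
  · rintro ⟨rfl, rfl, rfl, rfl⟩
    rfl

/-- The entries of the framed row `# u #`, indexed by natural numbers. -/
def rowEntry {A : Type} {m : ℕ} (u : Fin m → A) : ℕ → Option A
  | 0 => none
  | j + 1 => if h : j < m then some (u ⟨j, h⟩) else none

/-! ### Framed rows indexed by natural numbers -/

section rowEntry

variable {A : Type} {m : ℕ}

@[simp] theorem rowEntry_zero (u : Fin m → A) : rowEntry u 0 = none := rfl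

@[simp] theorem rowEntry_fin_succ (u : Fin m → A) (j : Fin m) :
    rowEntry u (j.val + 1) = some (u j) := by
  simp [rowEntry]

theorem rowEntry_succ_of_lt (u : Fin m → A) {j : ℕ} (h : j < m) :
    rowEntry u (j + 1) = some (u ⟨j, h⟩) := by
  simp [rowEntry, h]

theorem rowEntry_of_lt (u : Fin m → A) {j : ℕ} (h : m < j) : rowEntry u j = none := by
  cases j with
  | zero => rfl
  | succ j => simp [rowEntry, show ¬ j < m by omega]

theorem border_eq {n : ℕ} (b : A) (u : Fin n → A) (i : Fin (n + 2)) :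
    border b u i = (rowEntry u i.val).getD b := by
  obtain ⟨i, hi⟩ := i
  cases i with
  | zero => simp [border]
  | succ j =>
    by_cases h : j < n
    · simp [border, rowEntry, h]
    · simp [border, rowEntry, h]

theorem frameRow_eq (u : Fin m → A) (j : Fin (m + 2)) : frameRow u j = rowEntry u j.val := by
  obtain ⟨j, hj⟩ := j
  rw [frameRow, border_eq]
  cases j with
  | zero => rfl
  | succ j =>
    by_cases h : j < m
    · simp [rowEntry, h]
    · simp [rowEntry, h]

end rowEntry

/-! ### Pictures as sequences of rows -/

namespace TilingSystem

variable {Λ : Type} (S : TilingSystem Λ)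

/-- The two-row picture with rows `U 0 … U (m + 1)` and `V 0 … V (m + 1)` only has tiles of `S`. -/
def RowTiles (m : ℕ) (U V : ℕ → Option S.Alphabet) : Prop :=
  ∀ j ≤ m, tile (U j) (U (j + 1)) (V j) (V (j + 1)) ∈ S.tiles

variable {S} {n m : ℕ}

theorem nextRow_iff {u v : Fin m → S.Alphabet} :
    S.NextRow u v ↔ S.RowTiles m (rowEntry u) (rowEntry v) := by
  constructor
  · intro h j hj
    apply h
    exact ⟨0, j, by omega, by omega, by simp [frameRow_eq]⟩
  · rintro h _ ⟨i, j, hi, hj, rfl⟩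
    obtain rfl : i = 0 := by omega
    simpa [frameRow_eq] using h j (by omega)

theorem frame_apply (p : Picture S.Alphabet n m) (i : Fin (n + 2)) (j : Fin (m + 2)) :
    p.frame i j = (rowEntry p i.val).elim none (fun u => rowEntry u j.val) := by
  obtain ⟨i, hi⟩ := i
  rw [Picture.frame, border_eq]
  cases i with
  | zero => rfl
  | succ i =>
    by_cases h : i < n
    · simp [rowEntry_succ_of_lt, h, frameRow_eq]
    · simp [rowEntry_of_lt, show n < i + 1 by omega]

/-- The tiles of a framed picture split into three groups, according to whether their upper row is
the top frame, a row followed by another row, or the last row. -/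
theorem accepts_iff {k : ℕ} (p : Picture S.Alphabet (k + 1) m) :
    S.Accepts p ↔ S.RowTiles m (fun _ => none) (rowEntry (p 0)) ∧
      (∀ (r : ℕ) (hr : r < k), S.NextRow (p ⟨r, by omega⟩) (p ⟨r + 1, by omega⟩)) ∧
      S.RowTiles m (rowEntry (p (Fin.last k))) (fun _ => none) := by
  constructor
  · intro h
    have key : ∀ i j : ℕ, ∀ hi : i < k + 2, ∀ hj : j ≤ m,
        tile (p.frame ⟨i, by omega⟩ ⟨j, by omega⟩) (p.frame ⟨i, by omega⟩ ⟨j + 1, by omega⟩)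
          (p.frame ⟨i + 1, by omega⟩ ⟨j, by omega⟩)
          (p.frame ⟨i + 1, by omega⟩ ⟨j + 1, by omega⟩) ∈ S.tiles :=
      fun i j hi hj => h ⟨i, j, by omega, by omega, rfl⟩
    simp only [frame_apply] at key
    refine ⟨fun j hj => ?_, fun r hr => nextRow_iff.2 fun j hj => ?_, fun j hj => ?_⟩
    · simpa [rowEntry] using key 0 j (by omega) hj
    · have := key (r + 1) j (by omega) hj
      rw [rowEntry_succ_of_lt p (show r < k + 1 by omega),
        rowEntry_succ_of_lt p (show r + 1 < k + 1 by omega)] at this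
      exact this
    · have := key (k + 1) j (by omega) hj
      rw [rowEntry_succ_of_lt p (show k < k + 1 by omega),
        rowEntry_of_lt p (show k + 1 < k + 1 + 1 by omega)] at this
      exact this
  · rintro ⟨h₁, h₂, h₃⟩ _ ⟨i, j, hi, hj, rfl⟩
    have hj' : j ≤ m := by omega
    simp only [frame_apply]
    rcases Nat.eq_zero_or_pos i with rfl | hi0
    · simpa [rowEntry] using h₁ j hj'
    · obtain ⟨r, rfl⟩ : ∃ r, i = r + 1 := ⟨i - 1, by omega⟩
      rcases Nat.lt_or_ge r k with hr | hr
      · rw [rowEntry_succ_of_lt p (show r < k + 1 by omega),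
          rowEntry_succ_of_lt p (show r + 1 < k + 1 by omega)]
        exact nextRow_iff.1 (h₂ r hr) j hj'
      · obtain rfl : r = k := by omega
        rw [rowEntry_succ_of_lt p (show r < r + 1 by omega),
          rowEntry_of_lt p (show r + 1 < r + 1 + 1 by omega)]
        exact h₃ j hj'

theorem mem_language_iff (w : Fin m → Λ) :
    List.ofFn w ∈ S.language ↔ 0 < m ∧ ∃ (k : ℕ) (ρ : ℕ → Fin m → S.Alphabet),
      (ρ 0 = fun j => S.input (w j)) ∧ S.RowTiles m (fun _ => none) (rowEntry (ρ 0)) ∧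
      (∀ r < k, S.NextRow (ρ r) (ρ (r + 1))) ∧ S.RowTiles m (rowEntry (ρ k)) (fun _ => none) := by
  constructor
  · rintro ⟨n, m', hn, hm, p, hp, hw⟩
    obtain rfl : m = m' := by simpa using congrArg List.length hw
    obtain ⟨k, rfl⟩ : ∃ k, n = k + 1 := ⟨n - 1, by omega⟩
    rw [List.map_ofFn, List.ofFn_inj] at hw
    obtain ⟨h₁, h₂, h₃⟩ := (accepts_iff p).1 hp
    -- The value `p 0` beyond the last row is never inspected.
    refine ⟨hm, k, fun r => if h : r < k + 1 then p ⟨r, h⟩ else p 0, ?_, ?_, ?_, ?_⟩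
    · simpa [Function.comp_def] using hw.symm
    · simpa using h₁
    · intro r hr
      simpa [hr, show r < k + 1 by omega] using h₂ r hr
    · simpa [Fin.last] using h₃
  · rintro ⟨hm, k, ρ, h₀, h₁, h₂, h₃⟩
    refine ⟨k + 1, m, by omega, hm, fun i => ρ i, (accepts_iff _).2 ⟨h₁, h₂, h₃⟩, ?_⟩
    rw [List.map_ofFn, List.ofFn_inj]
    exact h₀.symm

end TilingSystem

/-! ### Automata over pairs of letters -/

namespace NFA

variable {A Q : Type} (N : NFA A Q)

@[simp] theorem evalFrom_empty (x : List A) : N.evalFrom ∅ x = ∅ := by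
  induction x with
  | nil => rfl
  | cons a x ih => simp [ih]

/-- The empty set of states is a sink, so it is not met along an accepted word. Hence the subsets
met along an accepted column are legitimate control states. -/
theorem eval_prefix_nonempty {x y : List A} (h : x ++ y ∈ N.accepts) : (N.eval x).Nonempty := by
  obtain ⟨s, -, hs⟩ := h
  rw [Set.nonempty_iff_ne_empty]
  intro hx
  rw [eval, evalFrom_append, ← eval, hx, evalFrom_empty] at hs
  exact hs

theorem mem_evalFrom_cons {s s' : Q} {a : A} {x : List A} :
    s' ∈ N.evalFrom {s} (a :: x) ↔ ∃ t ∈ N.step s a, s' ∈ N.evalFrom {t} x := by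
  rw [evalFrom_cons, stepSet_singleton, mem_evalFrom_iff_exists]

end NFA

/-- The relation computed by the iteration of `sideStep M z`. -/
def sideRun {Γ Q : Type} (M : NFA Γ Q) (z : VLetter Γ) :
    Option Q → List (VLetter Γ) → List Γ → Option Q → Prop
  | none, U, u, none => U = u.map .old
  | some s, U, u, some s' => U = List.replicate u.length z ∧ s' ∈ M.evalFrom {s} u
  | _, _, _, _ => False

/-- The relation `Id ∪ T_M`. -/
def SideRel {Γ Q : Type} (M : NFA Γ Q) (z : VLetter Γ) (U : List (VLetter Γ)) (u : List Γ) : Prop :=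
  U = u.map .old ∨ U = List.replicate u.length z ∧ u ∈ M.accepts

section side

variable {Γ Q : Type} {M : NFA Γ Q} {z : VLetter Γ}

theorem sideRun_nil {s s' : Option Q} : sideRun M z s [] [] s' ↔ s = s' := by
  cases s <;> cases s' <;> simp [sideRun, eq_comm]

theorem sideRun_cons {s s' : Option Q} {l : VLetter Γ} {c : Γ} {U : List (VLetter Γ)}
    {u : List Γ} :
    sideRun M z s (l :: U) (c :: u) s' ↔ ∃ t, sideStep M z s l c t ∧ sideRun M z t U u s' := by
  rcases s with _ | s <;> rcases s' with _ | s' <;>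
    simp [sideRun, sideStep, Option.exists, List.replicate_succ, -NFA.evalFrom_cons]
  rw [NFA.mem_evalFrom_cons]
  grind

/-- The state `none` satisfies both endpoint conditions vacuously, and a run never leaves its
branch, so the two branches give the two terms of the union. -/
theorem exists_sideRun_iff {U : List (VLetter Γ)} {u : List Γ} :
    (∃ s s', (∀ p ∈ s, p ∈ M.start) ∧ (∀ p ∈ s', p ∈ M.accept) ∧ sideRun M z s U u s') ↔
      SideRel M z U u := by
  simp only [SideRel, Option.exists, sideRun, NFA.mem_accepts]
  rw [show (∃ S ∈ M.accept, S ∈ M.evalFrom M.start u) ↔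
    ∃ S ∈ M.accept, ∃ t ∈ M.start, S ∈ M.evalFrom {t} u from by
      simp only [← NFA.mem_evalFrom_iff_exists]]
  simp
  grind

end side

namespace Transducer

variable {Γ : Type} {T : Transducer Γ}

theorem IsSynchronous.run_cons_iff (h : T.IsSynchronous) {p r : T.State} {c d : Γ}
    {u v : List Γ} :
    T.Run p (c :: u) (d :: v) r ↔ ∃ q, T.trans p (some c) (some d) q ∧ T.Run q u v r := by
  constructor
  · generalize hU : c :: u = U
    generalize hV : d :: v = V
    rintro (_ | @⟨_, q, _, x, y, u', v', ht, hr⟩)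
    · cases hU
    · obtain ⟨hx, hy⟩ := h _ _ _ _ ht
      obtain ⟨x, rfl⟩ := Option.ne_none_iff_exists'.1 hx
      obtain ⟨y, rfl⟩ := Option.ne_none_iff_exists'.1 hy
      simp only [Option.toList_some, List.cons_append, List.nil_append, List.cons.injEq] at hU hV
      obtain ⟨rfl, rfl⟩ := hU
      obtain ⟨rfl, rfl⟩ := hV
      exact ⟨q, ht, hr⟩
  · rintro ⟨q, ht, hr⟩
    exact Run.cons ht hr

theorem IsSynchronous.run_nil_iff (h : T.IsSynchronous) {p r : T.State} :
    T.Run p [] [] r ↔ p = r := by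
  constructor
  · intro hr
    suffices H : ∀ U V : List Γ, T.Run p U V r → U = [] → p = r from H _ _ hr rfl
    rintro _ _ (_ | @⟨_, q, _, x, y, u', v', ht, hr⟩) hU
    · rfl
    · obtain ⟨hx, -⟩ := h _ _ _ _ ht
      obtain ⟨x, rfl⟩ := Option.ne_none_iff_exists'.1 hx
      simp at hU
  · rintro rfl
    exact Run.nil _

theorem IsSynchronous.length_eq_of_run (h : T.IsSynchronous) {p q : T.State} {u v : List Γ}
    (hr : T.Run p u v q) : u.length = v.length := by
  induction hr with
  | nil => rfl
  | cons ht _ ih =>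
    obtain ⟨hx, hy⟩ := h _ _ _ _ ht
    obtain ⟨x, rfl⟩ := Option.ne_none_iff_exists'.1 hx
    obtain ⟨y, rfl⟩ := Option.ne_none_iff_exists'.1 hy
    simp [ih]

theorem IsSynchronous.length_eq_of_rel (h : T.IsSynchronous) {u v : List Γ}
    (hr : T.Rel u v) : u.length = v.length := by
  obtain ⟨q, -, hq⟩ := hr
  exact h.length_eq_of_run hq

variable {QI QF : Type} {MI : NFA Γ QI} {MF : NFA Γ QF}

/-- A product run guesses letter by letter the two intermediate words over `Γ`. Once these are
fixed, it splits into three independent runs, all reading one letter per step. -/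
theorem IsSynchronous.mem_extend_evalFrom_iff (h : T.IsSynchronous)
    (l : List (VLetter Γ × VLetter Γ)) (s s' : Option QI × T.State × Option QF) :
    s' ∈ (T.extend MI MF).evalFrom {s} l ↔ ∃ u v : List Γ, u.length = l.length ∧
      v.length = l.length ∧ sideRun MI .i s.1 (l.map Prod.fst) u s'.1 ∧ T.Run s.2.1 u v s'.2.1 ∧
      sideRun MF .f s.2.2 (l.map Prod.snd) v s'.2.2 := by
  induction l generalizing s with
  | nil =>
    simp [List.length_eq_zero_iff, sideRun_nil, h.run_nil_iff, Prod.ext_iff, eq_comm]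
  | cons a l ih =>
    rw [NFA.mem_evalFrom_cons]
    simp only [ih]
    constructor
    · rintro ⟨t, ⟨c, d, h₁, h₂, h₃⟩, u, v, hu, hv, k₁, k₂, k₃⟩
      exact ⟨c :: u, d :: v, by simp [hu], by simp [hv], sideRun_cons.2 ⟨_, h₁, k₁⟩,
        h.run_cons_iff.2 ⟨_, h₂, k₂⟩, sideRun_cons.2 ⟨_, h₃, k₃⟩⟩
    · rintro ⟨_ | ⟨c, u⟩, _ | ⟨d, v⟩, hu, hv, k₁, k₂, k₃⟩
      · simp at hu
      · simp at hu
      · simp at hv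
      · obtain ⟨t₁, h₁, k₁⟩ := sideRun_cons.1 k₁
        obtain ⟨t₂, h₂, k₂⟩ := h.run_cons_iff.1 k₂
        obtain ⟨t₃, h₃, k₃⟩ := sideRun_cons.1 k₃
        exact ⟨(t₁, t₂, t₃), ⟨c, d, h₁, h₂, h₃⟩, u, v, by simpa using hu, by simpa using hv,
          k₁, k₂, k₃⟩

theorem IsSynchronous.mem_extend_accepts_iff (h : T.IsSynchronous)
    (l : List (VLetter Γ × VLetter Γ)) :
    l ∈ (T.extend MI MF).accepts ↔ ∃ u v : List Γ, u.length = l.length ∧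
      v.length = l.length ∧ SideRel MI .i (l.map Prod.fst) u ∧ T.Rel u v ∧
      SideRel MF .f (l.map Prod.snd) v := by
  rw [NFA.mem_accepts]
  simp only [← exists_sideRun_iff]
  constructor
  · rintro ⟨s', ⟨a₁, a₂, a₃⟩, hs⟩
    obtain ⟨s, ⟨b₁, b₂, b₃⟩, hs⟩ := NFA.mem_evalFrom_iff_exists.1 hs
    obtain ⟨u, v, hu, hv, k₁, k₂, k₃⟩ := (h.mem_extend_evalFrom_iff _ _ _).1 hs
    exact ⟨u, v, hu, hv, ⟨_, _, b₁, a₁, k₁⟩, ⟨_, a₂, b₂ ▸ k₂⟩, ⟨_, _, b₃, a₃, k₃⟩⟩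
  · rintro ⟨u, v, hu, hv, ⟨s₁, s₁', b₁, a₁, k₁⟩, ⟨s₂', a₂, k₂⟩, ⟨s₃, s₃', b₃, a₃, k₃⟩⟩
    refine ⟨(s₁', s₂', s₃'), ⟨a₁, a₂, a₃⟩, NFA.mem_evalFrom_iff_exists.2
      ⟨(s₁, T.start, s₃), ⟨b₁, rfl, b₃⟩, ?_⟩⟩
    exact (h.mem_extend_evalFrom_iff _ _ _).2 ⟨u, v, hu, hv, k₁, k₂, k₃⟩

end Transducer

/-! ### Tiles as transitions down the columns -/

namespace RationalGraph

variable {Λ Γ QI QF : Type} {G : RationalGraph Λ Γ} {MI : NFA Γ QI} {MF : NFA Γ QF}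

theorem extend_start_nonempty (T : Transducer Γ) (MI : NFA Γ QI) (MF : NFA Γ QF) :
    (T.extend MI MF).start.Nonempty :=
  ⟨(none, T.start, none), by simp [Transducer.extend]⟩

/-- The control state in which the run along a column goes on below a given letter. -/
def control : G.TLetter MI MF → G.Control MI MF
  | .inl e => ⟨e, ⟨((G e).extend MI MF).start, extend_start_nonempty _ _ _, [], rfl⟩⟩
  | .inr (_, q) => q

/-- The vertex letter read from the entry to the left, which is `i` next to the frame. -/
def vertexLetter : Option (G.TLetter MI MF) → VLetter Γ
  | some (.inr (x, _)) => x
  | _ => .i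

theorem Control.IsStart.eq_control {q : G.Control MI MF} (h : q.IsStart) :
    q = control (.inl q.1) := by
  obtain ⟨e, P⟩ := q
  exact congrArg (Sigma.mk e) (Subtype.ext h)

theorem control_inl_isStart (e : Λ) : (control (.inl e : G.TLetter MI MF)).IsStart := rfl

theorem Control.trans_iff {q q' : G.Control MI MF} {x y : VLetter Γ} :
    q.Trans x y q' ↔ ∃ P, q' = ⟨q.1, P⟩ ∧ P.1 = ((G q.1).extend MI MF).stepSet q.2.1 (x, y) := by
  constructor
  · rintro ⟨h⟩
    exact ⟨_, rfl, h⟩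
  · rintro ⟨P, rfl, h⟩
    exact .intro h

theorem Control.Trans.fst_eq {q q' : G.Control MI MF} {x y : VLetter Γ} (h : q.Trans x y q') :
    q'.1 = q.1 := by
  obtain ⟨P, rfl, -⟩ := Control.trans_iff.1 h
  rfl

/-- The tile conditions on consecutive rows, in a column that is not the right border. -/
theorem SynchTile.column_step {nw sw : Option (G.TLetter MI MF)} {u v : G.TLetter MI MF}
    (h : SynchTile G MI MF (tile nw (some u) sw (some v))) :
    v.isRight ∧ (control u).Trans (vertexLetter sw) (vertexLetter (some v)) (control v) := by
  generalize ht : tile nw (some u) sw (some v) = t at h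
  cases h with
  | first_left x p₀ p h₀ h =>
    simp only [tile_inj, lab, cell, Option.some.injEq] at ht
    obtain ⟨rfl, rfl, rfl, rfl⟩ := ht
    exact ⟨rfl, h₀.eq_control ▸ h⟩
  | first_mid b y z q r₀ r h₀ h =>
    simp only [tile_inj, lab, cell, Option.some.injEq] at ht
    obtain ⟨rfl, rfl, rfl, rfl⟩ := ht
    exact ⟨rfl, h₀.eq_control ▸ h⟩
  | left x x' p p' h =>
    simp only [tile_inj, cell, Option.some.injEq] at ht
    obtain ⟨rfl, rfl, rfl, rfl⟩ := ht
    exact ⟨rfl, h⟩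
  | mid y y' z z' q q' r r' h =>
    simp only [tile_inj, cell, Option.some.injEq] at ht
    obtain ⟨rfl, rfl, rfl, rfl⟩ := ht
    exact ⟨rfl, h⟩
  | _ => simp [tile_inj, lab, cell] at ht

theorem SynchTile.right_border {u v : G.TLetter MI MF}
    (h : SynchTile G MI MF (tile (some u) none (some v) none)) :
    vertexLetter (some v) = .f := by
  generalize ht : tile (some u) none (some v) none = t at h
  cases h with
  | first_right s =>
    simp only [tile_inj, lab, cell, Option.some.injEq] at ht
    obtain ⟨-, -, rfl, -⟩ := ht
    rfl
  | right s s' h =>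
    simp only [tile_inj, cell, Option.some.injEq] at ht
    obtain ⟨-, -, rfl, -⟩ := ht
    rfl
  | _ => simp [tile_inj, lab, cell] at ht

theorem SynchTile.bottom_label {nw : Option (G.TLetter MI MF)} {e : Λ}
    (h : SynchTile G MI MF (tile nw (some (.inl e)) none none)) :
    EmptyVertex MI MF ∧ (G e).Rel [] [] := by
  generalize ht : tile nw (some (.inl e)) none none = t at h
  cases h with
  | empty_left a h₁ h₂ =>
    simp only [tile_inj, lab, Option.some.injEq, Sum.inl.injEq] at ht
    obtain ⟨-, rfl, -⟩ := ht
    exact ⟨h₁, h₂⟩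
  | empty_mid b c h₁ h₂ h₃ =>
    simp only [tile_inj, lab, Option.some.injEq, Sum.inl.injEq] at ht
    obtain ⟨-, rfl, -⟩ := ht
    exact ⟨h₁, h₃⟩
  | _ => simp [tile_inj, lab, cell] at ht

theorem SynchTile.bottom_cell {nw : Option (G.TLetter MI MF)} {x : VLetter Γ}
    {q : G.Control MI MF} (h : SynchTile G MI MF (tile nw (some (.inr (x, q))) none none)) :
    q.IsFinal := by
  generalize ht : tile nw (some (.inr (x, q))) none none = t at h
  cases h with
  | bottom_left x p h =>
    simp only [tile_inj, cell, Option.some.injEq, Sum.inr.injEq, Prod.mk.injEq] at ht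
    obtain ⟨-, ⟨-, rfl⟩, -⟩ := ht
    exact h
  | bottom_mid y z q r h₁ h₂ =>
    simp only [tile_inj, cell, Option.some.injEq, Sum.inr.injEq, Prod.mk.injEq] at ht
    obtain ⟨-, ⟨-, rfl⟩, -⟩ := ht
    exact h₂
  | _ => simp [tile_inj, lab, cell] at ht

section TilingSystem

variable [Finite Λ] [Finite Γ] [Finite QI] [Finite QF] {m : ℕ}

/-- The frame shifts columns by one: column `j` is entry `j + 1` of the framed row, and entry `j` is
its left neighbour. -/
theorem nextRow_column_step {u v : Fin m → G.TLetter MI MF}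
    (h : (G.toTilingSystem MI MF).NextRow u v) (j : Fin m) :
    (v j).isRight ∧ (control (u j)).Trans (vertexLetter (rowEntry v j))
      (vertexLetter (rowEntry v (j + 1))) (control (v j)) := by
  have := TilingSystem.nextRow_iff.1 h j j.2.le
  erw [rowEntry_fin_succ, rowEntry_fin_succ] at this
  rw [rowEntry_fin_succ]
  exact SynchTile.column_step this

theorem nextRow_right_border {u v : Fin m → G.TLetter MI MF} (hm : 0 < m)
    (h : (G.toTilingSystem MI MF).NextRow u v) : vertexLetter (rowEntry v m) = .f := by
  obtain ⟨k, rfl⟩ : ∃ k, m = k + 1 := ⟨m - 1, by omega⟩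
  have := TilingSystem.nextRow_iff.1 h (k + 1) le_rfl
  erw [rowEntry_succ_of_lt _ k.lt_succ_self, rowEntry_succ_of_lt _ k.lt_succ_self,
    rowEntry_of_lt _ (k + 1).lt_succ_self, rowEntry_of_lt _ (k + 1).lt_succ_self] at this
  rw [rowEntry_succ_of_lt _ k.lt_succ_self]
  exact SynchTile.right_border this

/-- The condition on `u` is needed because no tile puts a label next to a cell, and because a
right-border tile with a cell in its upper row requires the letter `f` there too. -/
theorem nextRow_of_column_step {u v : Fin m → G.TLetter MI MF} (hm : 0 < m)
    (hu : (∀ j, (u j).isLeft) ∨ (∀ j, (u j).isRight) ∧ vertexLetter (rowEntry u m) = .f)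
    (hv : ∀ j : Fin m, (v j).isRight ∧ (control (u j)).Trans (vertexLetter (rowEntry v j))
      (vertexLetter (rowEntry v (j + 1))) (control (v j)))
    (hf : vertexLetter (rowEntry v m) = .f) : (G.toTilingSystem MI MF).NextRow u v := by
  refine TilingSystem.nextRow_iff.2 fun j hj => ?_
  change SynchTile G MI MF (tile (rowEntry u j) (rowEntry u (j + 1)) (rowEntry v j)
    (rowEntry v (j + 1)))
  rcases Nat.eq_zero_or_pos j with rfl | hj0
  · obtain ⟨h₁, h₂⟩ := hv ⟨0, hm⟩
    simp only [rowEntry_succ_of_lt _ hm, rowEntry_zero] at h₂ ⊢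
    generalize u ⟨0, hm⟩ = x at *
    generalize v ⟨0, hm⟩ = y at *
    rcases y with _ | ⟨y, q⟩
    · simp at h₁
    · rcases x with e | ⟨x, p⟩
      · exact .first_left y (control (.inl e)) q (control_inl_isStart e) h₂
      · exact .left _ _ _ _ h₂
  · obtain ⟨i, rfl⟩ : ∃ i, j = i + 1 := ⟨j - 1, by omega⟩
    have hi : i < m := by omega
    obtain ⟨k₁, k₂⟩ := hv ⟨i, hi⟩
    rcases hj.lt_or_eq with hlt | rfl
    · obtain ⟨h₁, h₂⟩ := hv ⟨i + 1, hlt⟩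
      have hu' : ((u ⟨i, hi⟩).isLeft ∧ (u ⟨i + 1, hlt⟩).isLeft) ∨
          ((u ⟨i, hi⟩).isRight ∧ (u ⟨i + 1, hlt⟩).isRight) :=
        hu.imp (fun h => ⟨h _, h _⟩) (fun h => ⟨h.1 _, h.1 _⟩)
      simp only [rowEntry_succ_of_lt _ hlt, rowEntry_succ_of_lt _ hi] at h₂ ⊢
      clear k₂ hf hu
      generalize u ⟨i, hi⟩ = x at *
      generalize v ⟨i, hi⟩ = y at *
      generalize u ⟨i + 1, hlt⟩ = x' at *
      generalize v ⟨i + 1, hlt⟩ = y' at *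
      rcases y with _ | ⟨y, q⟩
      · simp at k₁
      rcases y' with _ | ⟨y', q'⟩
      · simp at h₁
      rcases x with e | ⟨x, p⟩ <;> rcases x' with e' | ⟨x', p'⟩
      · exact .first_mid e y y' q (control (.inl e')) q' (control_inl_isStart e') h₂
      · simp at hu'
      · simp at hu'
      · exact .mid _ _ _ _ _ _ _ _ h₂
    · have hu' : (u ⟨i, hi⟩).isLeft ∨ vertexLetter (rowEntry u (i + 1)) = .f :=
        hu.imp (fun h => h _) (fun h => h.2)
      -- A transition stays in one transducer, which is what the right-border tiles check.
      have k₃ := k₂.fst_eq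
      clear k₂ hv hu
      simp only [rowEntry_succ_of_lt _ hi, rowEntry_of_lt _ (Nat.lt_succ_self (i + 1))]
        at hu' hf ⊢
      generalize u ⟨i, hi⟩ = x at *
      generalize v ⟨i, hi⟩ = y at *
      rcases y with _ | ⟨y, q⟩
      · simp at k₁
      obtain rfl : y = .f := hf
      rcases x with e | ⟨x, p⟩
      · obtain rfl : q.1 = e := k₃
        exact .first_right q
      · obtain rfl : x = .f := by simpa [vertexLetter] using hu'
        exact .right p q k₃.symm

theorem rowTiles_top {u : Fin m → G.TLetter MI MF} (hm : 0 < m) (hu : ∀ j, (u j).isLeft) :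
    (G.toTilingSystem MI MF).RowTiles m (fun _ => none) (rowEntry u) := by
  have hu' : ∀ j (h : j < m), ∃ e, u ⟨j, h⟩ = .inl e := fun j h => Sum.isLeft_iff.1 (hu _)
  intro j hj
  change SynchTile G MI MF (tile none none (rowEntry u j) (rowEntry u (j + 1)))
  rcases Nat.eq_zero_or_pos j with rfl | hj0
  · obtain ⟨e, he⟩ := hu' 0 hm
    rw [rowEntry_succ_of_lt _ hm, rowEntry_zero, he]
    exact .top_left e
  · obtain ⟨i, rfl⟩ : ∃ i, j = i + 1 := ⟨j - 1, by omega⟩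
    obtain ⟨d, hd⟩ := hu' i (by omega)
    rw [rowEntry_succ_of_lt _ (show i < m by omega), hd]
    rcases hj.lt_or_eq with hlt | rfl
    · obtain ⟨e, he⟩ := hu' _ hlt
      rw [rowEntry_succ_of_lt _ hlt, he]
      exact .top_mid d e
    · rw [rowEntry_of_lt _ (Nat.lt_succ_self _)]
      exact .top_right d

theorem bottom_tile_mem {u : Fin m → G.TLetter MI MF}
    (h : (G.toTilingSystem MI MF).RowTiles m (rowEntry u) (fun _ => none)) (j : Fin m) :
    SynchTile G MI MF (tile (rowEntry u j) (some (u j)) none none) := by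
  have := h j j.2.le
  erw [rowEntry_fin_succ] at this
  exact this

theorem rowTiles_bottom_label {w : Fin m → Λ} (hm : 0 < m) (h : EmptyVertex MI MF)
    (hw : ∀ j, (G (w j)).Rel [] []) :
    (G.toTilingSystem MI MF).RowTiles m
      (rowEntry fun j => (.inl (w j) : G.TLetter MI MF)) (fun _ => none) := by
  intro j hj
  change SynchTile G MI MF (tile (rowEntry _ j) (rowEntry _ (j + 1)) none none)
  rcases Nat.eq_zero_or_pos j with rfl | hj0
  · rw [rowEntry_succ_of_lt _ hm, rowEntry_zero]
    exact .empty_left _ h (hw _)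
  · obtain ⟨i, rfl⟩ : ∃ i, j = i + 1 := ⟨j - 1, by omega⟩
    rw [rowEntry_succ_of_lt _ (show i < m by omega)]
    rcases hj.lt_or_eq with hlt | rfl
    · rw [rowEntry_succ_of_lt _ hlt]
      exact .empty_mid _ _ h (hw _) (hw _)
    · rw [rowEntry_of_lt _ (Nat.lt_succ_self _)]
      exact .empty_right _ h (hw _)

theorem rowTiles_bottom_cell {u : Fin m → G.TLetter MI MF} (hm : 0 < m)
    (hu : ∀ j, (u j).isRight) (hu' : ∀ j, (control (u j)).IsFinal)
    (hf : vertexLetter (rowEntry u m) = .f) :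
    (G.toTilingSystem MI MF).RowTiles m (rowEntry u) (fun _ => none) := by
  have key : ∀ j (h : j < m), ∃ x q, u ⟨j, h⟩ = .inr (x, q) ∧ q.IsFinal := by
    intro j h
    have h₂ := hu' ⟨j, h⟩
    obtain ⟨⟨x, q⟩, hq⟩ := Sum.isRight_iff.1 (hu ⟨j, h⟩)
    rw [hq] at h₂
    exact ⟨x, q, hq, h₂⟩
  intro j hj
  change SynchTile G MI MF (tile (rowEntry _ j) (rowEntry _ (j + 1)) none none)
  rcases Nat.eq_zero_or_pos j with rfl | hj0
  · obtain ⟨x, q, hq, h⟩ := key 0 hm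
    rw [rowEntry_succ_of_lt _ hm, rowEntry_zero, hq]
    exact .bottom_left x q h
  · obtain ⟨i, rfl⟩ : ∃ i, j = i + 1 := ⟨j - 1, by omega⟩
    have hi : i < m := by omega
    obtain ⟨x, q, hq, h⟩ := key i hi
    rcases hj.lt_or_eq with hlt | rfl
    · obtain ⟨x', q', hq', h'⟩ := key (i + 1) hlt
      rw [rowEntry_succ_of_lt _ hi, rowEntry_succ_of_lt _ hlt, hq, hq']
      exact .bottom_mid _ _ _ _ h h'
    · rw [rowEntry_succ_of_lt _ hi, hq] at hf
      obtain rfl : x = .f := hf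
      rw [rowEntry_of_lt _ (Nat.lt_succ_self _), rowEntry_succ_of_lt _ hi, hq]
      exact .bottom_right _ h

end TilingSystem

/-! ### Determinism -/

section Deterministic

theorem Control.Trans.stepSet_nonempty {q q' : G.Control MI MF} {x y : VLetter Γ}
    (h : q.Trans x y q') : (((G q.1).extend MI MF).stepSet q.2.1 (x, y)).Nonempty := by
  obtain ⟨P, -, hP⟩ := Control.trans_iff.1 h
  exact hP ▸ P.2.1

/-- The left side reads only `old` letters and `i`, so a step on `f` would lead to the empty set,
which is not a control state. -/
theorem Control.Trans.left_ne_f {q q' : G.Control MI MF} {x y : VLetter Γ}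
    (h : q.Trans x y q') : x ≠ .f := by
  rintro rfl
  obtain ⟨⟨s₁', _⟩, hs⟩ := h.stepSet_nonempty
  obtain ⟨⟨s₁, _⟩, -, c, d, hc, -⟩ := NFA.mem_stepSet.1 hs
  cases s₁ <;> cases s₁' <;> simp [sideStep] at hc

theorem sideStep_eq_old {Q : Type} {M : NFA Γ Q} {z l : VLetter Γ} {s s' : Option Q} {c : Γ}
    (h : sideStep M z s l c s') (hl : l ≠ z) : l = .old c := by
  cases s <;> cases s' <;> simp_all [sideStep]

/-- The letter `i` can only stand for `a`, and `old c` only for `c`. -/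
theorem sideStep_starNFA_unique {a : Γ} {l : VLetter Γ} {s s' t t' : Option Unit} {c d : Γ}
    (h : sideStep (starNFA a) .i s l c s') (h' : sideStep (starNFA a) .i t l d t') : c = d := by
  cases s <;> cases s' <;> cases t <;> cases t' <;> simp_all [sideStep, starNFA]

/-- The common left letter fixes the letter read by `T`; sequentiality then fixes its output `d` and
its next state. A right letter other than `f` is `old d`. -/
theorem _root_.Transducer.IsSequential.extend_step_unique {T : Transducer Γ}
    (h : T.IsSequential) {a : Γ} {x y y' : VLetter Γ}
    {s t s' t' : Option Unit × T.State × Option QF} (hst : s.2.1 = t.2.1)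
    (hs : s' ∈ (T.extend (starNFA a) MF).step s (x, y))
    (ht : t' ∈ (T.extend (starNFA a) MF).step t (x, y')) :
    s'.2.1 = t'.2.1 ∧ (y ≠ .f → y' ≠ .f → y = y') := by
  obtain ⟨c, d, h₁, h₂, h₃⟩ := hs
  obtain ⟨c', d', k₁, k₂, k₃⟩ := ht
  obtain rfl := sideStep_starNFA_unique h₁ k₁
  rw [hst] at h₂
  rcases h _ _ _ _ _ _ _ h₂ k₂ with ⟨-, hd, hq⟩ | ⟨-, -, hne⟩
  · refine ⟨hq, fun hy hy' => ?_⟩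
    rw [Option.some_inj] at hd
    rw [show y = _ from sideStep_eq_old h₃ hy, show y' = _ from sideStep_eq_old k₃ hy', hd]
  · exact absurd rfl hne

/-- The subsets need not be singletons, since the side components may vary, but the word read
determines the state of `T`. -/
theorem _root_.Transducer.IsSequential.eval_extend_subsingleton {T : Transducer Γ}
    (h : T.IsSequential) (a : Γ) (w : List (VLetter Γ × VLetter Γ)) :
    ∀ s ∈ (T.extend (starNFA a) MF).eval w, ∀ t ∈ (T.extend (starNFA a) MF).eval w,
      s.2.1 = t.2.1 := by
  induction w using List.reverseRecOn with
  | nil =>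
    intro s hs t ht
    exact hs.2.1.trans ht.2.1.symm
  | append_singleton w l ih =>
    intro s hs t ht
    rw [NFA.eval_append_singleton, NFA.mem_stepSet] at hs ht
    obtain ⟨s₀, hs₀, hs⟩ := hs
    obtain ⟨t₀, ht₀, ht⟩ := ht
    exact (h.extend_step_unique (ih _ hs₀ _ ht₀) hs ht).1

theorem Control.Trans.right_unique (hseq : G.IsSequential) {a : Γ}
    {q p p' : G.Control (starNFA a) MF} {x y y' : VLetter Γ} (h : q.Trans x y p)
    (h' : q.Trans x y' p') (hy : y ≠ .f) (hy' : y' ≠ .f) : y = y' := by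
  obtain ⟨s, hs⟩ := h.stepSet_nonempty
  obtain ⟨t, ht⟩ := h'.stepSet_nonempty
  obtain ⟨s₀, hs₀, hs⟩ := NFA.mem_stepSet.1 hs
  obtain ⟨t₀, ht₀, ht⟩ := NFA.mem_stepSet.1 ht
  -- Accessibility is used here: the subset is the value of a word `w`, so its members share their
  -- transducer state.
  obtain ⟨e, P, hP, w, rfl⟩ := q
  exact ((hseq e).extend_step_unique ((hseq e).eval_extend_subsingleton a w _ hs₀ _ ht₀)
    hs ht).2 hy hy'

theorem Control.Trans.target_unique {q p p' : G.Control MI MF} {x y : VLetter Γ}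
    (h : q.Trans x y p) (h' : q.Trans x y p') : p = p' := by
  obtain ⟨P, rfl, hP⟩ := Control.trans_iff.1 h
  obtain ⟨P', rfl, hP'⟩ := Control.trans_iff.1 h'
  rw [Subtype.ext (hP.trans hP'.symm)]

theorem eq_of_isRight {u v : G.TLetter MI MF} (hu : u.isRight) (hv : v.isRight)
    (h : vertexLetter (some u) = vertexLetter (some v)) (h' : control u = control v) : u = v := by
  rcases u with u | ⟨x, p⟩
  · simp at hu
  rcases v with v | ⟨y, q⟩
  · simp at hv
  obtain rfl : x = y := h
  obtain rfl : p = q := h'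
  rfl

theorem toTilingSystem_deterministic [Finite Λ] [Finite Γ] [Finite QF] (hseq : G.IsSequential)
    (a : Γ) (MF : NFA Γ QF) : (G.toTilingSystem (starNFA a) MF).Deterministic := by
  intro m (u : Fin m → G.TLetter _ MF) (v₁ : Fin m → G.TLetter _ MF)
    (v₂ : Fin m → G.TLetter _ MF) h₁ h₂
  suffices H : ∀ j ≤ m, rowEntry v₁ j = rowEntry v₂ j by
    funext j
    simpa using H (j + 1) j.2
  intro j hj
  induction j with
  | zero => rfl
  | succ j ih =>
    have hm : 0 < m := by omega
    obtain ⟨a₁, b₁⟩ := nextRow_column_step h₁ ⟨j, hj⟩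
    obtain ⟨a₂, b₂⟩ := nextRow_column_step h₂ ⟨j, hj⟩
    simp only at b₁ b₂
    rw [← ih (by omega)] at b₂
    have hx : vertexLetter (rowEntry v₁ (j + 1)) = vertexLetter (rowEntry v₂ (j + 1)) := by
      -- An inner letter is the left letter of a transition in the next column, so it is not `f`; in
      -- the last column both letters are `f`.
      rcases Nat.lt_or_ge (j + 1) m with hlt | hge
      · exact b₁.right_unique hseq b₂ (nextRow_column_step h₁ ⟨j + 1, hlt⟩).2.left_ne_f
          (nextRow_column_step h₂ ⟨j + 1, hlt⟩).2.left_ne_f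
      · obtain rfl : m = j + 1 := by omega
        rw [nextRow_right_border hm h₁, nextRow_right_border hm h₂]
    rw [← hx] at b₂
    have hq := b₁.target_unique b₂
    rw [rowEntry_succ_of_lt v₁ hj, rowEntry_succ_of_lt v₂ hj] at hx ⊢
    rw [eq_of_isRight a₁ a₂ hx hq]

end Deterministic

end RationalGraph

/-! ### Pictures as arrays of accepted columns -/

namespace RationalGraph

variable {Λ Γ QI QF : Type} {G : RationalGraph Λ Γ} {MI : NFA Γ QI} {MF : NFA Γ QF}

/-- The first `k` letters of the word of pairs read along column `j` of the array `X`. -/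
def columnWord (X : ℕ → ℕ → VLetter Γ) (j k : ℕ) : List (VLetter Γ × VLetter Γ) :=
  (List.range k).map fun r => (X j r, X (j + 1) r)

@[simp] theorem columnWord_length (X : ℕ → ℕ → VLetter Γ) (j k : ℕ) :
    (columnWord X j k).length = k := by
  simp [columnWord]

theorem columnWord_succ (X : ℕ → ℕ → VLetter Γ) (j k : ℕ) :
    columnWord X j (k + 1) = columnWord X j k ++ [(X j k, X (j + 1) k)] := by
  simp [columnWord, List.range_succ]

theorem columnWord_map_fst (X : ℕ → ℕ → VLetter Γ) (j k : ℕ) :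
    (columnWord X j k).map Prod.fst = (List.range k).map (X j) := by
  simp [columnWord, Function.comp_def]

theorem columnWord_map_snd (X : ℕ → ℕ → VLetter Γ) (j k : ℕ) :
    (columnWord X j k).map Prod.snd = (List.range k).map (X (j + 1)) := by
  simp [columnWord, Function.comp_def]

theorem columnWord_prefix (X : ℕ → ℕ → VLetter Γ) (j : ℕ) {r k : ℕ} (h : r ≤ k) :
    columnWord X j r <+: columnWord X j k :=
  (List.prefix_iff_eq_take.2 (by simp [List.take_range, h])).map _

section TilingSystem

variable [Finite Λ] [Finite Γ] [Finite QI] [Finite QF] {m : ℕ} {w : Fin m → Λ}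

/-- The columns of a picture of the tiling system are accepted by the automata over pairs of
letters. -/
def IsColumnArray (G : RationalGraph Λ Γ) (MI : NFA Γ QI) (MF : NFA Γ QF) (w : Fin m → Λ)
    (k : ℕ) (X : ℕ → ℕ → VLetter Γ) : Prop :=
  (∀ r < k, X 0 r = .i) ∧ (∀ r < k, X m r = .f) ∧
    ∀ j : Fin m, columnWord X j k ∈ ((G (w j)).extend MI MF).accepts

theorem IsColumnArray.of_rows {k : ℕ} (hk : 0 < k) (hm : 0 < m)
    {ρ : ℕ → Fin m → G.TLetter MI MF} (h₀ : ρ 0 = fun j => .inl (w j))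
    (h₂ : ∀ r < k, (G.toTilingSystem MI MF).NextRow (ρ r) (ρ (r + 1)))
    (h₃ : (G.toTilingSystem MI MF).RowTiles m (rowEntry (ρ k)) (fun _ => none)) :
    IsColumnArray G MI MF w k fun j r => vertexLetter (rowEntry (ρ (r + 1)) j) := by
  refine ⟨fun r _ => rfl, fun r hr => nextRow_right_border hm (h₂ r hr), fun j => ?_⟩
  set X : ℕ → ℕ → VLetter Γ := fun j r => vertexLetter (rowEntry (ρ (r + 1)) j) with hX
  -- By determinization, the control state is a function of the part of the column already read.
  have key : ∀ r ≤ k, ∃ P, control (ρ r j) = ⟨w j, P⟩ ∧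
      P.1 = ((G (w j)).extend MI MF).eval (columnWord X j r) := by
    intro r hr
    induction r with
    | zero =>
      rw [h₀]
      exact ⟨_, rfl, rfl⟩
    | succ r ih =>
      obtain ⟨P, hP, hP'⟩ := ih (by omega)
      have := (nextRow_column_step (h₂ r hr) j).2
      rw [hP] at this
      obtain ⟨P₁, e₁, e₂⟩ := Control.trans_iff.1 this
      refine ⟨P₁, e₁, ?_⟩
      rw [columnWord_succ, NFA.eval_append_singleton, ← hP']
      exact e₂
  obtain ⟨P, hP, hP'⟩ := key k le_rfl
  -- As `k > 0`, the last row follows another one and consists of cells, so its bottom tiles force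
  -- final states.
  obtain ⟨k', rfl⟩ : ∃ k', k = k' + 1 := ⟨k - 1, by omega⟩
  obtain ⟨⟨x, q⟩, hq⟩ := Sum.isRight_iff.1 (nextRow_column_step (h₂ k' k'.lt_succ_self) j).1
  have hb := bottom_tile_mem h₃ j
  rw [hq] at hb hP
  obtain ⟨s, hs, hs'⟩ := hb.bottom_cell
  obtain rfl : q = _ := hP
  exact ⟨s, hs', hP' ▸ hs⟩

theorem IsColumnArray.exists_rows {k : ℕ} (hk : 0 < k) (hm : 0 < m) {X : ℕ → ℕ → VLetter Γ}
    (h : IsColumnArray G MI MF w k X) :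
    ∃ ρ : ℕ → Fin m → G.TLetter MI MF, (ρ 0 = fun j => .inl (w j)) ∧
      (∀ r < k, (G.toTilingSystem MI MF).NextRow (ρ r) (ρ (r + 1))) ∧
      (G.toTilingSystem MI MF).RowTiles m (rowEntry (ρ k)) (fun _ => none) := by
  obtain ⟨hi, hf, hacc⟩ := h
  -- Control states are wanted for all `r`, but only prefixes of the accepted word are known to give
  -- nonempty subsets; hence the truncation at `k`.
  have hne : ∀ (r : ℕ) (j : Fin m),
      (((G (w j)).extend MI MF).eval (columnWord X j (min r k))).Nonempty := by
    intro r j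
    obtain ⟨y, hy⟩ := columnWord_prefix X j (min_le_right r k)
    exact NFA.eval_prefix_nonempty _ (hy ▸ hacc j)
  let st : ℕ → Fin m → G.Control MI MF := fun r j => ⟨w j, ⟨_, hne r j, _, rfl⟩⟩
  obtain ⟨ρ, hρ₀, hρ⟩ : ∃ ρ : ℕ → Fin m → G.TLetter MI MF, (∀ j, ρ 0 j = .inl (w j)) ∧
      ∀ r j, ρ (r + 1) j = .inr (X (j + 1) r, st (r + 1) j) :=
    ⟨fun r j => r.casesOn (.inl (w j)) fun r => .inr (X (j + 1) r, st (r + 1) j),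
      fun _ => rfl, fun _ _ => rfl⟩
  have hctl : ∀ r j, control (ρ r j) = st r j := by
    rintro (_ | r) j
    · rw [hρ₀]
      exact congrArg (Sigma.mk (w j)) (Subtype.ext (by simp [columnWord]))
    · rw [hρ]
      rfl
  have hlet : ∀ r < k, ∀ j ≤ m, vertexLetter (rowEntry (ρ (r + 1)) j) = X j r := by
    rintro r hr (_ | j) hj
    · exact (hi r hr).symm
    · rw [rowEntry_succ_of_lt _ hj, hρ]
      rfl
  obtain ⟨k', rfl⟩ : ∃ k', k = k' + 1 := ⟨k - 1, by omega⟩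
  have hstep : ∀ r < k' + 1, ∀ j : Fin m, (control (ρ r j)).Trans
      (vertexLetter (rowEntry (ρ (r + 1)) j)) (vertexLetter (rowEntry (ρ (r + 1)) (j + 1)))
      (control (ρ (r + 1) j)) := by
    intro r hr j
    rw [hctl, hctl, hlet r hr j j.2.le, hlet r hr (j + 1) j.2]
    refine Control.trans_iff.2 ⟨_, rfl, ?_⟩
    change ((G (w j)).extend MI MF).eval (columnWord X j (min (r + 1) (k' + 1))) =
      ((G (w j)).extend MI MF).stepSet
        (((G (w j)).extend MI MF).eval (columnWord X j (min r (k' + 1)))) _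
    rw [min_eq_left (show r + 1 ≤ k' + 1 from hr), min_eq_left hr.le, columnWord_succ,
      NFA.eval_append_singleton]
  have hfinal : ∀ j : Fin m, (control (ρ (k' + 1) j)).IsFinal := by
    intro j
    rw [hctl]
    obtain ⟨s, hs, hs'⟩ := hacc j
    refine ⟨s, ?_, hs⟩
    change s ∈ ((G (w j)).extend MI MF).eval (columnWord X j (min (k' + 1) (k' + 1)))
    rwa [min_self]
  refine ⟨ρ, funext hρ₀, fun r hr => nextRow_of_column_step hm ?_ (fun j => ⟨by simp [hρ], hstep r hr j⟩) ?_,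
    rowTiles_bottom_cell hm (fun _ => by simp [hρ]) hfinal ?_⟩
  · rcases r with _ | r
    · exact .inl fun _ => by simp [hρ₀]
    · refine .inr ⟨fun _ => by simp [hρ], ?_⟩
      rw [hlet r (by omega) m le_rfl, hf r (by omega)]
  · rw [hlet r hr m le_rfl, hf r hr]
  · rw [hlet k' k'.lt_succ_self m le_rfl, hf k' k'.lt_succ_self]

/-- With no row below the labels, the label row meets the bottom frame, and only the empty-vertex
tiles allow this. -/
theorem mem_toTilingSystem_language_iff :
    List.ofFn w ∈ (G.toTilingSystem MI MF).language ↔ 0 < m ∧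
      ((EmptyVertex MI MF ∧ ∀ j, (G (w j)).Rel [] []) ∨
        ∃ k > 0, ∃ X, IsColumnArray G MI MF w k X) := by
  rw [TilingSystem.mem_language_iff]
  refine and_congr_right fun hm => ⟨?_, ?_⟩
  · rintro ⟨k, ρ, h₀, -, h₂, h₃⟩
    rcases Nat.eq_zero_or_pos k with rfl | hk
    · have hb : ∀ j, EmptyVertex MI MF ∧ (G (w j)).Rel [] [] := by
        intro j
        have := bottom_tile_mem h₃ j
        rw [h₀] at this
        exact this.bottom_label
      exact .inl ⟨(hb ⟨0, hm⟩).1, fun j => (hb j).2⟩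
    · exact .inr ⟨k, hk, _, .of_rows hk hm h₀ h₂ h₃⟩
  · rintro (⟨h, hw⟩ | ⟨k, hk, X, hX⟩)
    · exact ⟨0, fun _ j => .inl (w j), rfl, rowTiles_top hm fun _ => rfl,
        fun r hr => absurd hr r.not_lt_zero, rowTiles_bottom_label hm h hw⟩
    · obtain ⟨ρ, h₀, h₂, h₃⟩ := hX.exists_rows hk hm
      refine ⟨k, ρ, h₀, ?_, h₂, h₃⟩
      refine rowTiles_top hm ?_
      rw [h₀]
      exact fun _ => rfl

end TilingSystem

/-! ### Column arrays and paths -/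

theorem hasPath_ofFn_iff {m : ℕ} {w : Fin m → Λ} {s t : List Γ} :
    G.HasPath (List.ofFn w) s t ↔ ∃ x : ℕ → List Γ, x 0 = s ∧ x m = t ∧
      ∀ j : Fin m, (G (w j)).Rel (x j) (x (j + 1)) := by
  induction m generalizing s with
  | zero =>
    constructor
    · intro h
      rw [List.ofFn_zero] at h
      cases h
      exact ⟨fun _ => t, rfl, rfl, fun j => j.elim0⟩
    · rintro ⟨x, rfl, rfl, -⟩
      exact .nil _
  | succ m ih =>
    rw [List.ofFn_succ]
    constructor
    · intro h
      cases h with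
      | cons h₁ h₂ =>
        obtain ⟨x, rfl, rfl, hx⟩ := ih.1 h₂
        refine ⟨fun j => j.casesOn s x, rfl, rfl, fun j => ?_⟩
        cases j using Fin.cases with
        | zero => exact h₁
        | succ j => exact hx j
    · rintro ⟨x, rfl, rfl, hx⟩
      exact .cons (hx 0) (ih.2 ⟨fun j => x (j + 1), rfl, rfl, fun j => hx j.succ⟩)

theorem IsColumnArray.exists_vertices (hsync : G.IsSynchronous) {m k : ℕ} {w : Fin m → Λ}
    (hk : 0 < k) (hm : 0 < m) {X : ℕ → ℕ → VLetter Γ} (h : IsColumnArray G MI MF w k X) :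
    ∃ x : ℕ → List Γ, x 0 ∈ MI.accepts ∧ x m ∈ MF.accepts ∧
      ∀ j : Fin m, (G (w j)).Rel (x j) (x (j + 1)) := by
  obtain ⟨hi, hf, hacc⟩ := h
  choose u v hu hv h₁ h₂ h₃ using
    fun j : Fin m => ((hsync (w j)).mem_extend_accepts_iff _).1 (hacc j)
  simp only [columnWord_map_fst, columnWord_map_snd, columnWord_length] at hu hv h₁ h₃
  -- Since `k > 0` there is a first letter, and it is `i`: the leftmost side cannot take the
  -- identity branch.
  have old_i : ∀ y : List Γ, y.length = k → (List.range k).map (X 0) ≠ y.map .old := by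
    intro y hy heq
    obtain ⟨c, y, rfl⟩ := List.exists_cons_of_length_pos (hy ▸ hk)
    have := congrArg List.head? heq
    obtain ⟨k', rfl⟩ : ∃ k', k = k' + 1 := ⟨k - 1, by omega⟩
    simp [List.range_succ_eq_map, hi 0 hk] at this
  have old_f : ∀ y : List Γ, y.length = k → (List.range k).map (X m) ≠ y.map .old := by
    intro y hy heq
    obtain ⟨c, y, rfl⟩ := List.exists_cons_of_length_pos (hy ▸ hk)
    have := congrArg List.head? heq
    obtain ⟨k', rfl⟩ : ∃ k', k = k' + 1 := ⟨k - 1, by omega⟩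
    simp [List.range_succ_eq_map, hf 0 hk] at this
  -- A nonempty inner column is read as an output and as an input. The letters `f`, `i` and `old`
  -- are incompatible, so both readings are the identity.
  have middle : ∀ (U : List (VLetter Γ)) (y z : List Γ), y.length = k → SideRel MF .f U y →
      SideRel MI .i U z → y = z := by
    intro U y z hy hU hU'
    obtain ⟨c, y, rfl⟩ := List.exists_cons_of_length_pos (hy ▸ hk)
    rcases z with _ | ⟨d, z⟩
    · rcases hU with rfl | ⟨rfl, -⟩ <;> rcases hU' with hU' | ⟨hU', -⟩ <;>
        simp [List.replicate_succ] at hU'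
    · rcases hU with rfl | ⟨rfl, -⟩ <;> rcases hU' with hU' | ⟨hU', -⟩
      · exact List.map_injective_iff.2 (fun a b h => VLetter.old.inj h) hU'
      all_goals simp [List.replicate_succ] at hU'
  -- Vertex `0` is the input of column `0` and vertex `j + 1` the output of column `j`; the default
  -- `[]` lies beyond the path.
  refine ⟨fun j => j.casesOn (u ⟨0, hm⟩) fun j => if h : j < m then v ⟨j, h⟩ else [], ?_, ?_,
    fun ⟨j, hj⟩ => ?_⟩
  · exact ((h₁ ⟨0, hm⟩).resolve_left (old_i _ (hu _))).2
  · obtain ⟨m', rfl⟩ : ∃ m', m = m' + 1 := ⟨m - 1, by omega⟩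
    simpa using ((h₃ ⟨m', by omega⟩).resolve_left (old_f _ (hv _))).2
  · rcases j with _ | j
    · simpa [hm] using h₂ ⟨0, hm⟩
    · have hj' : j < m := by omega
      have := middle _ _ _ (hv ⟨j, hj'⟩) (h₃ ⟨j, hj'⟩) (h₁ ⟨j + 1, hj⟩)
      simpa [hj, hj', this] using h₂ ⟨j + 1, hj⟩

/-- The array whose inner columns hold the vertices `x 1 … x (m - 1)`. -/
def vertexArray (m : ℕ) (x : ℕ → List Γ) (j r : ℕ) : VLetter Γ :=
  if j = 0 then .i else if j = m then .f else (x j)[r]?.elim .f .old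

/-- Inner vertices use the identity branches, the first one the branch of `MI` and the last one that
of `MF`; for `m = 1` a single column uses both. The default `f` in inner columns is not reached, as
all vertices have length `k`. -/
theorem isColumnArray_vertexArray (hsync : G.IsSynchronous) {m k : ℕ} {w : Fin m → Λ}
    (hm : 0 < m) {x : ℕ → List Γ} (hx : ∀ j ≤ m, (x j).length = k) (h₀ : x 0 ∈ MI.accepts)
    (h₁ : x m ∈ MF.accepts) (h : ∀ j : Fin m, (G (w j)).Rel (x j) (x (j + 1))) :
    IsColumnArray G MI MF w k (vertexArray m x) := by
  have key : ∀ j ≤ m, j ≠ 0 → j ≠ m →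
      (List.range k).map (vertexArray m x j) = (x j).map .old := by
    intro j hj hj0 hjm
    refine List.ext_getElem (by simp [hx j hj]) fun r hr hr' => ?_
    simp at hr'
    simp [vertexArray, hj0, hjm, hr']
  refine ⟨fun r _ => by simp [vertexArray], fun r _ => by simp [vertexArray, hm.ne'],
    fun j => ((hsync _).mem_extend_accepts_iff _).2 ⟨x j, x (j + 1), ?_, ?_, ?_, h j, ?_⟩⟩
  · simp [hx j j.2.le]
  · simp [hx (j + 1) j.2]
  · rw [columnWord_map_fst]
    by_cases hj : j.val = 0
    · right
      rw [hj, hx 0 hm.le]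
      exact ⟨List.eq_replicate_iff.2 ⟨by simp, by simp [vertexArray]⟩, h₀⟩
    · exact .inl (key j j.2.le hj j.2.ne)
  · rw [columnWord_map_snd]
    by_cases hj : j.val + 1 = m
    · right
      rw [hj, hx m le_rfl]
      exact ⟨List.eq_replicate_iff.2 ⟨by simp, by simp [vertexArray, hm.ne']⟩, h₁⟩
    · exact .inl (key _ j.2 (by omega) hj)

theorem toTilingSystem_language [Finite Λ] [Finite Γ] [Finite QI] [Finite QF]
    (hsync : G.IsSynchronous) (MI : NFA Γ QI) (MF : NFA Γ QF) :
    (G.toTilingSystem MI MF).language = G.pathLanguage MI.accepts MF.accepts := by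
  ext l
  obtain ⟨m, w, rfl⟩ : ∃ (m : ℕ) (w : Fin m → Λ), l = List.ofFn w :=
    ⟨l.length, l.get, (List.ofFn_get l).symm⟩
  rw [mem_toTilingSystem_language_iff]
  have hne : List.ofFn w ≠ [] ↔ 0 < m := by
    rw [Ne, List.ofFn_eq_nil_iff, Nat.pos_iff_ne_zero]
  change _ ↔ List.ofFn w ≠ [] ∧ _
  rw [hne]
  refine and_congr_right fun hm => ⟨?_, ?_⟩
  · rintro (⟨⟨hI, hF⟩, hw⟩ | ⟨k, hk, X, hX⟩)
    · exact ⟨[], hI, [], hF, hasPath_ofFn_iff.2 ⟨fun _ => [], rfl, rfl, hw⟩⟩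
    · obtain ⟨x, hI, hF, hx⟩ := hX.exists_vertices hsync hk hm
      exact ⟨_, hI, _, hF, hasPath_ofFn_iff.2 ⟨x, rfl, rfl, hx⟩⟩
  · rintro ⟨s, hs, t, ht, h⟩
    obtain ⟨x, rfl, rfl, hx⟩ := hasPath_ofFn_iff.1 h
    have hlen : ∀ j ≤ m, (x j).length = (x 0).length := by
      intro j hj
      induction j with
      | zero => rfl
      | succ j ih =>
        rw [← ih (by omega)]
        exact ((hsync _).length_eq_of_rel (hx ⟨j, hj⟩)).symm
    -- The common length of the vertices is the number of rows below the labels; length `0` falls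
    -- under the empty-vertex tiles.
    rcases Nat.eq_zero_or_pos (x 0).length with h0 | hpos
    · have hnil : ∀ j ≤ m, x j = [] := fun j hj =>
        List.length_eq_zero_iff.1 ((hlen j hj).trans h0)
      refine .inl ⟨⟨hnil 0 hm.le ▸ hs, hnil m le_rfl ▸ ht⟩, fun j => ?_⟩
      have := hx j
      rwa [hnil j j.2.le, hnil _ j.2] at this
    · exact .inr ⟨_, hpos, _, isColumnArray_vertexArray hsync hm hlen hs ht hx⟩

end RationalGraph

/-! ### The automaton of `{a}*` and the conclusion -/

theorem mem_accepts_starNFA {Γ : Type} {a : Γ} {x : List Γ} :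
    x ∈ (starNFA a).accepts ↔ ∀ c ∈ x, c = a := by
  rw [NFA.accepts_eq_acceptsFrom_start]
  -- The set of states varies for the induction: a letter other than `a` empties it.
  have key : ∀ S : Set Unit, x ∈ (starNFA a).acceptsFrom S ↔ S.Nonempty ∧ ∀ c ∈ x, c = a := by
    induction x with
    | nil => simp [starNFA, Set.Nonempty]
    | cons c x ih =>
      intro S
      rw [NFA.cons_mem_acceptsFrom, ih, List.forall_mem_cons, ← and_assoc]
      refine and_congr_left' ?_
      simp [NFA.stepSet, starNFA, Set.Nonempty]
  rw [key]
  simp [starNFA]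

theorem accepts_starNFA {Γ : Type} (a : Γ) :
    (starNFA a).accepts = ({[a]} : Language Γ)∗ := by
  ext x
  rw [mem_accepts_starNFA, Language.mem_kstar]
  constructor
  · intro h
    refine ⟨x.map fun c => [c], ?_, ?_⟩
    · clear h
      induction x with
      | nil => rfl
      | cons c x ih => simpa using ih
    · rintro _ hy
      obtain ⟨c, hc, rfl⟩ := List.mem_map.1 hy
      rw [h c hc]
      rfl
  · rintro ⟨L, rfl, hL⟩ c hc
    obtain ⟨y, hy, hc⟩ := List.mem_flatten.1 hc
    obtain rfl : y = [a] := hL y hy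
    simpa using hc

theorem mainTheorem10 {Λ Γ : Type} [Finite Λ] [Finite Γ] (G : RationalGraph Λ Γ)
    (hsync : G.IsSynchronous) (hseq : G.IsSequential) (a : Γ) :
    (∀ F : Language Γ, F.IsRegular →
      IsDeterministicContextSensitive (G.pathLanguage ({[a]} : Language Γ)∗ F)) ∧
    (∀ (QF : Type) [Finite QF] (MF : NFA Γ QF),
      (G.toTilingSystem (starNFA a) MF).Deterministic ∧
      (G.toTilingSystem (starNFA a) MF).language =
        G.pathLanguage ({[a]} : Language Γ)∗ MF.accepts) := by
  have key : ∀ (QF : Type) [Finite QF] (MF : NFA Γ QF),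
      (G.toTilingSystem (starNFA a) MF).Deterministic ∧
      (G.toTilingSystem (starNFA a) MF).language =
        G.pathLanguage ({[a]} : Language Γ)∗ MF.accepts := by
    intro QF _ MF
    refine ⟨RationalGraph.toTilingSystem_deterministic hseq a MF, ?_⟩
    rw [RationalGraph.toTilingSystem_language hsync, accepts_starNFA]
  refine ⟨?_, key⟩
  rintro _ ⟨σ, _, M, rfl⟩
  obtain ⟨hd, hl⟩ := key σ M.toNFA
  exact ⟨_, hd, by rw [hl, DFA.toNFA_correct]⟩
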